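/- Algebraic circuits over a field $\mathbb F$ are finite directed acyclic graphs whose nodes are input variables, constants of $\mathbb F$, or sum and product gates of unbounded fan-in; the size is the number of nodes plus the number of wires, and the depth is the number of wires on a longest directed path ending at the output. An algebraic formula is an algebraic circuit whose graph is a rooted tree (its size is the number of nodes). Let $\mathrm{Esym}_i(\mathbf x)=\sum_{S\subseteq[n],\,|S|=i}\prod_{j\in S}x_j$. Theorem. There are an absolute constant $c>0$, an absolute polynomial bound $\mathrm{poly}$ and an absolute constant $k$ such that the following holds. Let $n,d,s\in\mathbb N$, let $\mathbb F$ be a field (finite or infinite, of any characteristic) with $|\mathbb F|\ge (nds)^c$, and let $P\in\mathbb F[x_1,\dots,x_n]$ be a symmetric polynomial of degree at most $d$. Then there is a unique polynomial $Q\in\mathbb F[z_1,\dots,z_n]$ with $P(\mathbf x)=Q(\mathrm{Esym}_1(\mathbf x),\dots,\mathrm{Esym}_n(\mathbf x))$, its degree is at most $d$, and: 1. for every $\Delta\in\mathbb N$, if $P$ is computed by an algebraic circuit over $\mathbb F$ of size at most $s$ and depth at most $\Delta$, then $Q$ is computed by an algebraic circuit over $\mathbb F$ of size at most $\mathrm{poly}(s,d,n)$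 and depth at most $\Delta+k$; 2. if $P$ is computed by an algebraic formula over $\mathbb F$ of size at most $s$, then $Q$ is computed by an algebraic formula over $\mathbb F$ of size at most $\mathrm{poly}(s,d,n)$. -/

import Mathlib

universe u v

/-! Algebraic circuits and formulas over `F` in the variables `σ`, with unbounded fan-in
addition and multiplication gates and with arbitrary field constants. -/

/-- The label of a node of an algebraic circuit whose nodes are the elements of `V`: an input
variable, a field constant, or a sum or product gate together with its (ordered) list of `k`
incoming wires; the same node may feed a gate through several wires. -/
inductive AlgGate (F : Type u) (σ : Type v) (V : Type) : Type (max u v)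
  | var (i : σ) : AlgGate F σ V
  | const (a : F) : AlgGate F σ V
  | sum (k : ℕ) (f : Fin k → V) : AlgGate F σ V
  | prod (k : ℕ) (f : Fin k → V) : AlgGate F σ V

namespace AlgGate

/-- The number of wires that enter the node. -/
def fanIn {F : Type u} {σ : Type v} {V : Type} : AlgGate F σ V → ℕ
  | var _ => 0
  | const _ => 0
  | sum k _ => k
  | prod k _ => k

/-- The node from which the `j`-th incoming wire comes. -/
def child {F : Type u} {σ : Type v} {V : Type} : (g : AlgGate F σ V) → Fin g.fanIn → V
  | var _, j => j.elim0
  | const _, j => j.elim0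
  | sum _ f, j => f j
  | prod _ f, j => f j

/-- The polynomial computed at the node from the polynomials arriving on the incoming wires. -/
noncomputable def apply {F : Type u} [CommSemiring F] {σ : Type v} {V : Type} :
    (g : AlgGate F σ V) → (Fin g.fanIn → MvPolynomial σ F) → MvPolynomial σ F
  | var i, _ => MvPolynomial.X i
  | const a, _ => MvPolynomial.C a
  | sum k _, x => ∑ j : Fin k, x j
  | prod k _, x => ∏ j : Fin k, x j

end AlgGate

/-- An algebraic circuit: a finite directed acyclic graph with labelled nodes and a designated
output node. (For a finite graph, acyclicity is well-foundedness of the relation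
"there is a wire from `a` to `b`".) -/
structure AlgCircuit (F : Type u) (σ : Type v) where
  V : Type
  fintypeV : Fintype V
  gate : V → AlgGate F σ V
  acyclic : WellFounded fun a b : V => ∃ j, (gate b).child j = a
  output : V

namespace AlgCircuit

/-- The polynomial computed at a node. -/
noncomputable def value {F : Type u} [CommSemiring F] {σ : Type v} (C : AlgCircuit F σ) :
    C.V → MvPolynomial σ F :=
  C.acyclic.fix fun b ih => (C.gate b).apply fun j => ih ((C.gate b).child j) ⟨j, rfl⟩

/-- The length (number of wires) of a longest directed path that ends at a node. -/
noncomputable def nodeDepth {F : Type u} {σ : Type v} (C : AlgCircuit F σ) : C.V → ℕ :=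
  C.acyclic.fix fun b ih => Finset.univ.sup fun j => ih ((C.gate b).child j) ⟨j, rfl⟩ + 1

theorem value_eq {F : Type u} [CommSemiring F] {σ : Type v} (C : AlgCircuit F σ) (b : C.V) :
    C.value b = (C.gate b).apply fun j => C.value ((C.gate b).child j) :=
  C.acyclic.fix_eq _ b

theorem nodeDepth_eq {F : Type u} {σ : Type v} (C : AlgCircuit F σ) (b : C.V) :
    C.nodeDepth b = Finset.univ.sup fun j => C.nodeDepth ((C.gate b).child j) + 1 :=
  C.acyclic.fix_eq _ b

/-- The polynomial computed by the circuit. -/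
noncomputable def poly {F : Type u} [CommSemiring F] {σ : Type v} (C : AlgCircuit F σ) :
    MvPolynomial σ F :=
  C.value C.output

/-- The depth: the length of a longest directed path that ends at the output. -/
noncomputable def depth {F : Type u} {σ : Type v} (C : AlgCircuit F σ) : ℕ :=
  C.nodeDepth C.output

/-- The size: the number of nodes plus the number of wires. -/
def size {F : Type u} {σ : Type v} (C : AlgCircuit F σ) : ℕ :=
  letI := C.fintypeV
  Fintype.card C.V + ∑ b : C.V, (C.gate b).fanIn

end AlgCircuit

/-- An algebraic formula, i.e. an algebraic circuit whose underlying graph is a rooted tree. -/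
inductive AlgFormula (F : Type u) (σ : Type v) : Type (max u v)
  | var (i : σ) : AlgFormula F σ
  | const (a : F) : AlgFormula F σ
  | sum (k : ℕ) (f : Fin k → AlgFormula F σ) : AlgFormula F σ
  | prod (k : ℕ) (f : Fin k → AlgFormula F σ) : AlgFormula F σ

namespace AlgFormula

/-- The polynomial computed by the formula. -/
noncomputable def poly {F : Type u} [CommSemiring F] {σ : Type v} :
    AlgFormula F σ → MvPolynomial σ F
  | var i => MvPolynomial.X i
  | const a => MvPolynomial.C a
  | sum _ f => ∑ j, (f j).poly
  | prod _ f => ∏ j, (f j).poly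

/-- The size: the number of nodes of the tree. -/
def size {F : Type u} {σ : Type v} : AlgFormula F σ → ℕ
  | var _ => 1
  | const _ => 1
  | sum _ f => 1 + ∑ j, (f j).size
  | prod _ f => 1 + ∑ j, (f j).size

end AlgFormula

/-- `P` is computed by an algebraic circuit of size at most `s` and depth at most `Δ`. -/
def HasCircuit {F : Type u} [CommSemiring F] {σ : Type v} (P : MvPolynomial σ F) (s Δ : ℕ) :
    Prop :=
  ∃ C : AlgCircuit F σ, C.poly = P ∧ C.size ≤ s ∧ C.depth ≤ Δ

/-- `P` is computed by an algebraic formula of size at most `s`. -/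
def HasFormula {F : Type u} [CommSemiring F] {σ : Type v} (P : MvPolynomial σ F) (s : ℕ) :
    Prop :=
  ∃ Φ : AlgFormula F σ, Φ.poly = P ∧ Φ.size ≤ s

/-- `Q(Esym₁(x), …, Esymₙ(x))`; the variable of `Q` with index `i : Fin n` (counted from `0`)
is replaced by the elementary symmetric polynomial of degree `i + 1`. -/
noncomputable def compEsym {F : Type u} [CommSemiring F] {n : ℕ} (Q : MvPolynomial (Fin n) F) :
    MvPolynomial (Fin n) F :=
  MvPolynomial.aeval (fun i : Fin n => MvPolynomial.esymm (Fin n) F ((i : ℕ) + 1)) Q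

-- Fix distinct a_1, …, a_n in F, let f = ∏ (X - a_i) and ζ_l = z_l - e_l(a), and move the
-- coefficients of f along the line f + w g, where g has the signed coefficients ζ_l. Modulo w^(d+1)
-- the simple roots a_i deform to roots r_i(w) (`exists_perturbed_roots`) whose elementary symmetric
-- functions are e_l(a) + w ζ_l. Hence P(r(w)) ≡ Q(e(a) + w ζ) mod w^(d+1). The right side has
-- degree at most d in w, because deg Q ≤ d (`totalDegree_le_of_compEsym`), and it equals Q(z) at w
-- = 1. So Q is the sum of the first d + 1 coefficients in w of P(r(w)), and interpolation in w
-- makes it a linear combination of substitutions into P (`exists_eq_sum_bind₁_rootApprox`).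
--
-- It remains to compute the truncated roots in constant depth, in every characteristic. Write f =
-- (X - a) h, φ = -g/h expanded at a in the variable u, and L(G) = Σ_k w^k [u^k] φ^k G. A form of
-- Lagrange inversion without the factors 1/k gives y = L(u) / L(1) for the root a + y
-- (`lagrangeFunctional_root`). Each coefficient [u^k] here is a fixed linear functional of g^k,
-- hence a combination of values g(v_j)^k, and 1 / L(1) is a finite geometric series since L(1) ≡ 1
-- mod w (`exists_rootApprox`). Circuits and formulas are then handled together by
-- `IsComplexityMeasure`.

universe w

/-! ### Linear functionals on polynomials of bounded degree as combinations of evaluations -/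

-- Invertibility of the Vandermonde matrix. The weights are found over F and serve every F-algebra
-- at once, so they do not depend on the perturbation.
open Polynomial in
theorem exists_interpolation_weights {F : Type u} [Field F] {N : ℕ} {v : Fin N → F}
    (hv : Function.Injective v) (τ : ℕ → F) :
    ∃ c : Fin N → F, ∀ (S : Type u) [CommRing S] [Algebra F S] (p : S[X]), p.natDegree < N →
      ∑ l ∈ Finset.range N, p.coeff l * algebraMap F S (τ l) =
        ∑ j, algebraMap F S (c j) * p.eval (algebraMap F S (v j)) := by
  have hdet : IsUnit (Matrix.vandermonde v) := by
    rw [Matrix.isUnit_iff_isUnit_det, isUnit_iff_ne_zero]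
    exact Matrix.det_vandermonde_ne_zero_iff.2 hv
  obtain ⟨c, hc⟩ := Matrix.vecMul_surjective_iff_isUnit.2 hdet (fun l : Fin N => τ l)
  refine ⟨c, fun S _ _ p hp => ?_⟩
  have hc' : ∀ l : Fin N, τ l = ∑ j, c j * v j ^ (l : ℕ) := fun l => by
    rw [← congrFun hc l]; rfl
  rw [Finset.sum_range]
  simp_rw [Polynomial.eval_eq_sum_range' hp, Finset.sum_range, Finset.mul_sum, hc', map_sum,
    Finset.mul_sum]
  rw [Finset.sum_comm]
  refine Finset.sum_congr rfl fun j _ => Finset.sum_congr rfl fun l _ => ?_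
  simp only [map_mul, map_pow]; ring

/-! ### A root of a perturbed polynomial, by Lagrange inversion -/

/-- `Σ_{k ≤ d} w ^ k [u ^ k] (φ ^ k G)`. -/
noncomputable def lagrangeFunctional {S : Type u} [CommRing S] (d : ℕ) (w : S)
    (φ G : PowerSeries S) : S :=
  ∑ k ∈ Finset.range (d + 1), w ^ k * PowerSeries.coeff k (φ ^ k * G)

theorem lagrangeFunctional_sub_C_mul {S : Type u} [CommRing S] (d : ℕ) (w y : S)
    (φ G H : PowerSeries S) :
    lagrangeFunctional d w φ (G - PowerSeries.C y * H) =
      lagrangeFunctional d w φ G - y * lagrangeFunctional d w φ H := by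
  simp only [lagrangeFunctional, Finset.mul_sum, ← Finset.sum_sub_distrib]
  refine Finset.sum_congr rfl fun k _ => ?_
  rw [mul_sub, map_sub, mul_left_comm, PowerSeries.coeff_C_mul]; ring

/-- The k-th term is w^k [u^(k-1)] φ^k G - w^(k+1) [u^k] φ^(k+1) G, so the sum telescopes and its
last term carries w^(d+1). -/
theorem lagrangeFunctional_kernel {S : Type u} [CommRing S] {d : ℕ} {w : S}
    (hw : w ^ (d + 1) = 0) (φ G : PowerSeries S) :
    lagrangeFunctional d w φ ((PowerSeries.X - PowerSeries.C w * φ) * G) = 0 := by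
  have key : ∀ m : ℕ, ∑ k ∈ Finset.range (m + 1),
      w ^ k * PowerSeries.coeff k (φ ^ k * ((PowerSeries.X - PowerSeries.C w * φ) * G)) =
      - (w ^ (m + 1) * PowerSeries.coeff m (φ ^ (m + 1) * G)) := by
    intro m
    induction m with
    | zero =>
      simp [sub_mul, mul_assoc]
    | succ m ih =>
      rw [Finset.sum_range_succ, ih]
      have : φ ^ (m + 1) * ((PowerSeries.X - PowerSeries.C w * φ) * G) =
        PowerSeries.X * (φ ^ (m + 1) * G) - PowerSeries.C w * (φ ^ (m + 2) * G) := by ring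
      rw [this, map_sub, PowerSeries.coeff_succ_X_mul, PowerSeries.coeff_C_mul]
      ring
  rw [lagrangeFunctional, key, hw]; simp

open Polynomial in
/-- The Taylor expansion of a polynomial at `a`, as a power series. -/
noncomputable def expandAt {S : Type u} [CommRing S] (a : S) : S[X] →+* PowerSeries S :=
  Polynomial.eval₂RingHom PowerSeries.C (PowerSeries.X + PowerSeries.C a)

open Polynomial in
theorem constantCoeff_expandAt {S : Type u} [CommRing S] (a : S) (p : S[X]) :
    PowerSeries.constantCoeff (expandAt a p) = p.eval a := by
  rw [expandAt, Polynomial.coe_eval₂RingHom, Polynomial.hom_eval₂,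
    show (PowerSeries.constantCoeff (R := S)).comp PowerSeries.C = RingHom.id S by ext; simp,
    Polynomial.eval₂_id]
  simp

-- Around a, the perturbed polynomial is both (u - wφ) h and (u - y) H with h and H units, so u - y
-- is a multiple of u - wφ and is killed by the functional.
open Polynomial in
theorem lagrangeFunctional_root {S : Type u} [CommRing S] {d : ℕ} {w : S}
    (hw : w ^ (d + 1) = 0) (a y : S) (hy : IsNilpotent y) (g h : S[X])
    (hu : IsUnit (h.eval a)) (θ : PowerSeries S) (hθ : expandAt a h * θ = 1)
    (hroot : ((X - C a) * h + C w * g).eval (a + y) = 0) :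
    lagrangeFunctional d w (- (expandAt a g * θ)) PowerSeries.X =
      y * lagrangeFunctional d w (- (expandAt a g * θ)) 1 := by
  obtain ⟨H, hH⟩ := Polynomial.dvd_iff_isRoot.2 hroot
  have hder := congrArg (fun p => (derivative p).eval a) hH
  simp only [derivative_mul, derivative_add, derivative_sub, derivative_X, derivative_C, eval_add,
    eval_mul, eval_sub, eval_X, eval_C, eval_zero, eval_one] at hder
  have hwn : IsNilpotent w := ⟨_, hw⟩
  -- Comparing derivatives at a gives H(a) = h(a) + w g'(a) + y H'(a), a unit plus a nilpotent.
  have hHa : IsUnit (H.eval a) := by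
    have e : H.eval a = h.eval a + (w * (derivative g).eval a + y * (derivative H).eval a) := by
      linear_combination -hder
    rw [e]
    refine IsNilpotent.isUnit_add_left_of_commute ?_ hu (Commute.all _ _)
    exact (Commute.all _ _).isNilpotent_add ((Commute.all _ _).isNilpotent_mul_right hwn)
      ((Commute.all _ _).isNilpotent_mul_right hy)
  have hHu : IsUnit (expandAt a H) := by
    rw [PowerSeries.isUnit_iff_constantCoeff, constantCoeff_expandAt]; exact hHa
  obtain ⟨I, hI⟩ := hHu.exists_right_inv
  have hX : expandAt a (X - C a) = PowerSeries.X := by simp [expandAt]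
  have hC : ∀ b : S, expandAt a (C b) = PowerSeries.C b := fun b => by simp [expandAt]
  have hX' : expandAt a (X - C (a + y)) = PowerSeries.X - PowerSeries.C y := by
    simp [expandAt]; ring
  have hE := congrArg (expandAt a) hH
  rw [map_add, map_mul, map_mul, map_mul, hX, hC, hX'] at hE
  have hker := lagrangeFunctional_kernel hw (- (expandAt a g * θ)) (expandAt a h * I)
  have e : (PowerSeries.X - PowerSeries.C w * (- (expandAt a g * θ))) * (expandAt a h * I) =
      PowerSeries.X - PowerSeries.C y * 1 := by
    linear_combination I * hE + PowerSeries.C w * expandAt a g * I * hθ +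
      (PowerSeries.X - PowerSeries.C y) * hI
  rw [e, lagrangeFunctional_sub_C_mul] at hker
  exact sub_eq_zero.1 hker

/-- `Σ_{k ≤ d} Σ_j c_{k,j} x_j ^ k`. -/
noncomputable def powerSum {F : Type u} [Field F] {N : ℕ} (d : ℕ) (c : ℕ → Fin N → F)
    {S : Type u} [CommRing S] [Algebra F S] (x : Fin N → S) : S :=
  ∑ k ∈ Finset.range (d + 1), ∑ j, algebraMap F S (c k j) * x j ^ k

theorem map_powerSum {F : Type u} [Field F] {N : ℕ} (d : ℕ) (c : ℕ → Fin N → F)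
    {S T : Type u} [CommRing S] [Algebra F S] [CommRing T] [Algebra F T] (f : S →ₐ[F] T)
    (x : Fin N → S) : f (powerSum d c x) = powerSum d c fun j => f (x j) := by
  simp [powerSum, map_sum]

open Polynomial in
theorem exists_powerSum_eq_lagrangeFunctional {F : Type u} [Field F] {N : ℕ} {v : Fin N → F}
    (hv : Function.Injective v) (d : ℕ) (a : F) (θ G : PowerSeries F) :
    ∃ c : ℕ → Fin N → F, ∀ (S : Type u) [CommRing S] [Algebra F S] (w : S) (g : S[X]),
      d * g.natDegree < N →
      lagrangeFunctional d w
        (- (expandAt (algebraMap F S a) g * PowerSeries.map (algebraMap F S) θ))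
        (PowerSeries.map (algebraMap F S) G) =
      powerSum d c fun j => w * g.eval (algebraMap F S (v j)) := by
  -- The functional for k sends the monomial X^l to [u^k] of (u + a)^l (-θ)^k G; it is applied to
  -- g^k, of degree at most d · deg g.
  choose c hc using fun k : ℕ => exists_interpolation_weights hv
    fun l => PowerSeries.coeff k ((PowerSeries.X + PowerSeries.C a) ^ l * ((-θ) ^ k * G))
  refine ⟨c, fun S _ _ w g hg => ?_⟩
  refine Finset.sum_congr rfl fun k hk => ?_
  have hdeg : (g ^ k).natDegree < N := by
    refine lt_of_le_of_lt (natDegree_pow_le.trans (Nat.mul_le_mul_right _ ?_)) hg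
    exact Nat.lt_succ_iff.1 (Finset.mem_range.1 hk)
  have h1 : (-(expandAt (algebraMap F S a) g * PowerSeries.map (algebraMap F S) θ)) ^ k *
      PowerSeries.map (algebraMap F S) G = expandAt (algebraMap F S a) (g ^ k) *
        PowerSeries.map (algebraMap F S) ((-θ) ^ k * G) := by
    simp only [map_mul, map_pow, map_neg]
    rw [← mul_neg, mul_pow]; ring
  have h2 : expandAt (algebraMap F S a) (g ^ k) = ∑ l ∈ Finset.range N,
      PowerSeries.C ((g ^ k).coeff l) *
        PowerSeries.map (algebraMap F S) ((PowerSeries.X + PowerSeries.C a) ^ l) := by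
    rw [expandAt, coe_eval₂RingHom, eval₂_eq_sum_range' _ hdeg]
    simp
  rw [h1, h2, Finset.sum_mul, map_sum]
  simp_rw [mul_assoc, PowerSeries.coeff_C_mul, ← map_mul, PowerSeries.coeff_map]
  rw [hc k S (g ^ k) hdeg, Finset.mul_sum]
  refine Finset.sum_congr rfl fun j _ => ?_
  rw [eval_pow, mul_pow]; ring

/-- The coefficients of a root of a perturbed polynomial, as a combination of powers of the values
of the perturbation. -/
noncomputable def rootApprox {F : Type u} [Field F] {N : ℕ} (d : ℕ) (a : F)
    (α β : ℕ → Fin N → F) {S : Type u} [CommRing S] [Algebra F S] (x : Fin N → S) : S :=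
  algebraMap F S a + powerSum d β x * ∑ m ∈ Finset.range (d + 1), (1 - powerSum d α x) ^ m

theorem map_rootApprox {F : Type u} [Field F] {N : ℕ} (d : ℕ) (a : F) (α β : ℕ → Fin N → F)
    {S T : Type u} [CommRing S] [Algebra F S] [CommRing T] [Algebra F T] (f : S →ₐ[F] T)
    (x : Fin N → S) : f (rootApprox d a α β x) = rootApprox d a α β fun j => f (x j) := by
  simp [rootApprox, map_powerSum, map_sum]

open Polynomial in
theorem exists_rootApprox {F : Type u} [Field F] {N : ℕ} {v : Fin N → F}
    (hv : Function.Injective v) (d : ℕ) (a : F) (h : F[X]) (ha : h.eval a ≠ 0) :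
    ∃ α β : ℕ → Fin N → F, ∀ (S : Type u) [CommRing S] [Algebra F S] (w : S),
      w ^ (d + 1) = 0 → ∀ g : S[X], d * g.natDegree < N → ∀ y : S, IsNilpotent y →
      (((X - C a) * h).map (algebraMap F S) + C w * g).eval (algebraMap F S a + y) = 0 →
      algebraMap F S a + y = rootApprox d a α β fun j => w * g.eval (algebraMap F S (v j)) := by
  have hu : IsUnit (expandAt a h) := by
    rw [PowerSeries.isUnit_iff_constantCoeff, constantCoeff_expandAt]; exact ha.isUnit
  obtain ⟨θ, hθ⟩ := hu.exists_right_inv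
  obtain ⟨α, hα⟩ := exists_powerSum_eq_lagrangeFunctional hv d a θ 1
  obtain ⟨β, hβ⟩ := exists_powerSum_eq_lagrangeFunctional hv d a θ PowerSeries.X
  refine ⟨α, β, fun S _ _ w hw g hg y hy hroot => ?_⟩
  have hmap : expandAt (algebraMap F S a) (h.map (algebraMap F S)) =
      PowerSeries.map (algebraMap F S) (expandAt a h) := by
    simp only [expandAt, coe_eval₂RingHom, hom_eval₂, eval₂_map]
    congr 1
    · ext; simp
    · simp
  have key := lagrangeFunctional_root hw (algebraMap F S a) y hy g (h.map (algebraMap F S))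
    (by rw [eval_map_algebraMap, aeval_algebraMap_apply_eq_algebraMap_eval]
        exact ha.isUnit.map _)
    (PowerSeries.map (algebraMap F S) θ) (by rw [hmap, ← map_mul, hθ, map_one])
    (by simpa using hroot)
  have hα' := hα S w g hg
  have hβ' := hβ S w g hg
  rw [map_one] at hα'
  rw [PowerSeries.map_X] at hβ'
  rw [hα', hβ'] at key
  -- The term k = 0 of the functional at 1 is 1 and all others are divisible by w, so the geometric
  -- series inverting it stops after d + 1 terms.
  have hnil : (1 - powerSum d α fun j => w * g.eval (algebraMap F S (v j))) ^ (d + 1) = 0 := by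
    rw [← hα', lagrangeFunctional, Finset.sum_range_succ']
    have : w ∣ ∑ k ∈ Finset.range d, w ^ (k + 1) * PowerSeries.coeff (k + 1)
        ((-(expandAt (algebraMap F S a) g * PowerSeries.map (algebraMap F S) θ)) ^ (k + 1) * 1) :=
      Finset.dvd_sum fun k _ => (dvd_pow_self w k.succ_ne_zero).mul_right _
    obtain ⟨b, hb⟩ := this
    rw [hb]
    simp [mul_pow, hw, neg_pow (w * b)]
  rw [rootApprox, key]
  have hgeom := mul_neg_geom_sum (1 - powerSum d α fun j => w * g.eval (algebraMap F S (v j)))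
    (d + 1)
  rw [hnil] at hgeom
  linear_combination -y * hgeom

/-! ### Elementary symmetric polynomials of the approximate roots -/

open Polynomial in
theorem coeff_prod_X_sub_C {F : Type u} [Field F] {S : Type u} [CommRing S] [Algebra F S] {n : ℕ}
    (ρ : Fin n → S) (l : Fin n) :
    (∏ i, (X - C (ρ i))).coeff (n - 1 - l) =
      (-1) ^ ((l : ℕ) + 1) * MvPolynomial.aeval ρ (MvPolynomial.esymm (Fin n) F (l + 1)) := by
  have h := Multiset.prod_X_sub_C_coeff (Finset.univ.val.map ρ) (k := n - 1 - l)
    (by simp; omega)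
  have e : n - (n - 1 - l) = l + 1 := by omega
  rw [MvPolynomial.aeval_esymm_eq_multiset_esymm]
  rw [Multiset.map_map, Multiset.card_map, Finset.card_val, Finset.card_univ, Fintype.card_fin,
    e] at h
  exact h

open Polynomial in
/-- The polynomial of degree less than `n` with coefficients `ζ`, up to signs, listed from the
coefficient of `X ^ (n - 1)` downwards. -/
noncomputable def signedPoly {S : Type u} [CommRing S] {n : ℕ} (ζ : Fin n → S) : S[X] :=
  ∑ l : Fin n, C ((-1) ^ ((l : ℕ) + 1) * ζ l) * X ^ (n - 1 - (l : ℕ))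

open Polynomial in
theorem coeff_signedPoly {S : Type u} [CommRing S] {n : ℕ} (ζ : Fin n → S) (l : Fin n) :
    (signedPoly ζ).coeff (n - 1 - l) = (-1) ^ ((l : ℕ) + 1) * ζ l := by
  rw [signedPoly, finsetSum_coeff, Finset.sum_eq_single l]
  · rw [coeff_C_mul_X_pow, if_pos rfl]
  · intro b _ hb
    rw [coeff_C_mul_X_pow, if_neg]
    intro h
    exact hb (Fin.ext (by omega))
  · simp

open Polynomial in
theorem natDegree_signedPoly_le {S : Type u} [CommRing S] {n : ℕ} (ζ : Fin n → S) :
    (signedPoly ζ).natDegree ≤ n - 1 :=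
  natDegree_sum_le_of_forall_le _ _ fun _ _ =>
    (natDegree_C_mul_X_pow_le _ _).trans (Nat.sub_le _ _)

open Polynomial in
theorem eval_signedPoly {S : Type u} [CommRing S] {n : ℕ} (ζ : Fin n → S) (v : S) :
    (signedPoly ζ).eval v =
      ∑ l : Fin n, (-1) ^ ((l : ℕ) + 1) * ζ l * v ^ (n - 1 - (l : ℕ)) := by
  simp [signedPoly, eval_finsetSum]

open Polynomial in
theorem eval_prod_erase_ne_zero {F : Type u} [Field F] {n : ℕ} {a : Fin n → F}
    (ha : Function.Injective a) (i : Fin n) :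
    (∏ j ∈ Finset.univ.erase i, (X - C (a j))).eval (a i) ≠ 0 := by
  rw [eval_prod, Finset.prod_ne_zero_iff]
  intro j hj
  simpa [sub_eq_zero] using ha.ne (Finset.ne_of_mem_erase hj).symm

-- Each a_i is a simple root up to nilpotents, so Newton iteration lifts it. Differences of lifted
-- roots are units plus nilpotents, so the linear factors are pairwise coprime and their product
-- divides the perturbed polynomial; both are monic of degree n.
open Polynomial in
theorem exists_perturbed_roots {F : Type u} [Field F] {S : Type u} [CommRing S] [Algebra F S]
    {n : ℕ} {a : Fin n → F} (ha : Function.Injective a) {w : S} (hw : IsNilpotent w)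
    {g : S[X]} (hg : g.natDegree < n) :
    ∃ y : Fin n → S, (∀ i, IsNilpotent (y i)) ∧
      (∀ i, ((∏ i, (X - C (a i))).map (algebraMap F S) + C w * g).eval
        (algebraMap F S (a i) + y i) = 0) ∧
      ∏ i, (X - C (algebraMap F S (a i) + y i)) =
        (∏ i, (X - C (a i))).map (algebraMap F S) + C w * g := by
  nontriviality S
  set f : F[X] := ∏ i, (X - C (a i)) with hf
  have hfm : f.Monic := monic_prod_of_monic _ _ fun i _ => monic_X_sub_C _
  have hfd : f.natDegree = n := by
    rw [hf, natDegree_prod_of_monic _ _ fun i _ => monic_X_sub_C _]; simp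
  set p := f.map (algebraMap F S) + C w * g with hp
  have hdeg : (C w * g).degree < (f.map (algebraMap F S)).degree := by
    rw [degree_eq_natDegree (hfm.map _).ne_zero, hfm.natDegree_map, hfd]
    exact degree_le_natDegree.trans_lt (by exact_mod_cast (natDegree_C_mul_le w g).trans_lt hg)
  have hpm : p.Monic := (hfm.map _).add_of_left hdeg
  have hpd : p.natDegree = n := by
    rw [hp, natDegree_add_eq_left_of_degree_lt hdeg, hfm.natDegree_map, hfd]
  have hroot : ∀ i, ∃ y : S, IsNilpotent y ∧ p.eval (algebraMap F S (a i) + y) = 0 := by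
    intro i
    have h0 : f.eval (a i) = 0 := by
      rw [hf, eval_prod]; exact Finset.prod_eq_zero (Finset.mem_univ i) (by simp)
    have h1 : (derivative f).eval (a i) ≠ 0 := by
      rw [hf, ← Finset.mul_prod_erase _ (fun j => X - C (a j)) (Finset.mem_univ i),
        derivative_mul, eval_add, eval_mul, eval_mul]
      simpa using eval_prod_erase_ne_zero ha i
    obtain ⟨r, ⟨hr, hr'⟩, -⟩ := existsUnique_nilpotent_sub_and_aeval_eq_zero (R := S) (S := S)
      (P := p) (x := algebraMap F S (a i))
      (by
        rw [coe_aeval_eq_eval, hp, eval_add, eval_map_algebraMap,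
          aeval_algebraMap_apply_eq_algebraMap_eval, h0, map_zero, zero_add, eval_mul, eval_C]
        exact (Commute.all _ _).isNilpotent_mul_right hw)
      (by
        rw [coe_aeval_eq_eval, hp, derivative_add, eval_add, derivative_map, eval_map_algebraMap,
          aeval_algebraMap_apply_eq_algebraMap_eval, derivative_C_mul, eval_mul, eval_C]
        exact IsNilpotent.isUnit_add_left_of_commute
          ((Commute.all _ _).isNilpotent_mul_right hw) (h1.isUnit.map _) (Commute.all _ _))
    refine ⟨r - algebraMap F S (a i), ?_, ?_⟩
    · rw [← neg_sub]; exact hr.neg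
    · rw [add_sub_cancel]; simpa using hr'
  choose y hy hy' using hroot
  refine ⟨y, hy, hy', ?_⟩
  have hdvd : ∏ i, (X - C (algebraMap F S (a i) + y i)) ∣ p := by
    refine Finset.prod_dvd_of_coprime (fun i _ j _ hij => ?_) fun i _ => dvd_iff_isRoot.2 (hy' i)
    refine isCoprime_X_sub_C_of_isUnit_sub ?_
    rw [add_sub_add_comm, ← map_sub]
    exact IsNilpotent.isUnit_add_left_of_commute ((Commute.all _ _).isNilpotent_sub (hy i) (hy j))
      ((sub_ne_zero.2 (ha.ne hij)).isUnit.map _) (Commute.all _ _)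
  have hm : (∏ i, (X - C (algebraMap F S (a i) + y i))).Monic :=
    monic_prod_of_monic _ _ fun i _ => monic_X_sub_C _
  refine (eq_of_monic_of_dvd_of_natDegree_le hm hpm hdvd ?_).symm
  rw [natDegree_prod_of_monic _ _ fun i _ => monic_X_sub_C _, hpd]
  simp only [natDegree_X_sub_C]; simp

-- By Vieta, comparing coefficients in the factorization over the lifted roots; nilpotence of w lets
-- `rootApprox` equal these roots exactly.
open Polynomial in
theorem exists_aeval_rootApprox_esymm {F : Type u} [Field F] {n N d : ℕ} (hN : d * (n - 1) < N)
    {a : Fin n → F} (ha : Function.Injective a) {v : Fin N → F} (hv : Function.Injective v) :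
    ∃ α β : Fin n → ℕ → Fin N → F, ∀ (S : Type u) [CommRing S] [Algebra F S] (w : S),
      w ^ (d + 1) = 0 → ∀ (ζ : Fin n → S) (l : Fin n),
      MvPolynomial.aeval (fun i => rootApprox d (a i) (α i) (β i)
        fun j => w * (signedPoly ζ).eval (algebraMap F S (v j)))
        (MvPolynomial.esymm (Fin n) F (l + 1)) =
      algebraMap F S (MvPolynomial.aeval a (MvPolynomial.esymm (Fin n) F (l + 1))) + w * ζ l := by
  choose α β h using fun i => exists_rootApprox hv d (a i) _ (eval_prod_erase_ne_zero ha i)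
  refine ⟨α, β, fun S _ _ w hw ζ l => ?_⟩
  have hdeg := natDegree_signedPoly_le ζ
  obtain ⟨y, hy, hy', hprod⟩ := exists_perturbed_roots ha ⟨_, hw⟩
    (g := signedPoly ζ) (hdeg.trans_lt (by have := l.2; omega))
  have hr : ∀ i, rootApprox d (a i) (α i) (β i)
      (fun j => w * (signedPoly ζ).eval (algebraMap F S (v j))) = algebraMap F S (a i) + y i := by
    intro i
    refine (h i S w hw _ ((Nat.mul_le_mul_left d hdeg).trans_lt hN) (y i) (hy i) ?_).symm
    rw [Finset.mul_prod_erase _ (fun j => X - C (a j)) (Finset.mem_univ i)]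
    exact hy' i
  simp_rw [hr]
  have hc := congrArg (fun p => p.coeff (n - 1 - l)) hprod
  simp only [coeff_add, coeff_map, coeff_C_mul] at hc
  rw [coeff_prod_X_sub_C (F := F), coeff_prod_X_sub_C (F := F), coeff_signedPoly, map_mul, map_pow,
    map_neg, map_one] at hc
  have hu : IsUnit ((-1 : S) ^ ((l : ℕ) + 1)) := (isUnit_one.neg).pow _
  refine hu.mul_left_cancel ?_
  rw [hc]; ring

/-! ### Recovering a polynomial in the elementary symmetric polynomials -/

open Polynomial in
theorem natDegree_aeval_le {F : Type u} [Field F] {R : Type u} [CommRing R] [Algebra F R] {n : ℕ}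
    {k m : ℕ} (P : MvPolynomial (Fin n) F) (hP : P.totalDegree ≤ k) (f : Fin n → R[X])
    (hf : ∀ i, (f i).natDegree ≤ m) : (MvPolynomial.aeval f P).natDegree ≤ k * m := by
  have h : MvPolynomial.aeval f P =
      MvPolynomial.aeval f (MvPolynomial.map (algebraMap F R) P) := by
    rw [MvPolynomial.aeval_map_algebraMap]
  rw [h]
  exact MvPolynomial.aeval_natDegree_le _
    ((Finset.sup_mono (MvPolynomial.support_map_subset _ _)).trans hP) f hf

open Polynomial in
theorem natDegree_powerSum_le {F : Type u} [Field F] {N : ℕ} (d : ℕ) (c : ℕ → Fin N → F)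
    {R : Type u} [CommRing R] [Algebra F R] (x : Fin N → R[X]) (hx : ∀ j, (x j).natDegree ≤ 1) :
    (powerSum d c x).natDegree ≤ d := by
  refine natDegree_sum_le_of_forall_le _ _ fun k hk => natDegree_sum_le_of_forall_le _ _
    fun j _ => ?_
  rw [Polynomial.algebraMap_apply]
  refine (natDegree_C_mul_le _ _).trans (natDegree_pow_le.trans ?_)
  have := Finset.mem_range.1 hk
  nlinarith [Nat.mul_le_mul_left k (hx j)]

open Polynomial in
theorem natDegree_rootApprox_le {F : Type u} [Field F] {N : ℕ} (d : ℕ) (a : F)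
    (α β : ℕ → Fin N → F) {R : Type u} [CommRing R] [Algebra F R] (x : Fin N → R[X])
    (hx : ∀ j, (x j).natDegree ≤ 1) : (rootApprox d a α β x).natDegree ≤ d + d * d := by
  refine natDegree_add_le_of_degree_le ?_ (natDegree_mul_le.trans ?_)
  · rw [Polynomial.algebraMap_apply, natDegree_C]; exact Nat.zero_le _
  · refine add_le_add (natDegree_powerSum_le d β x hx)
      (natDegree_sum_le_of_forall_le _ _ fun m hm => natDegree_pow_le.trans ?_)
    refine Nat.mul_le_mul (Nat.lt_succ_iff.1 (Finset.mem_range.1 hm)) ?_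
    refine (natDegree_sub_le _ _).trans (max_le ?_ (natDegree_powerSum_le d α x hx))
    rw [natDegree_one]; exact Nat.zero_le _

open Polynomial in
theorem natDegree_X_mul_C_le {R : Type u} [CommRing R] (r : R) :
    (X * C r : R[X]).natDegree ≤ 1 :=
  (natDegree_mul_C_le _ _).trans natDegree_X_le

/-- The coordinates centered at the elementary symmetric polynomials of the point `a`. -/
noncomputable def centered {F : Type u} [Field F] {n : ℕ} (a : Fin n → F) (l : Fin n) :
    MvPolynomial (Fin n) F :=
  MvPolynomial.X l -
    MvPolynomial.C (MvPolynomial.aeval a (MvPolynomial.esymm (Fin n) F ((l : ℕ) + 1)))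

open Polynomial in
theorem exists_eq_sum_bind₁_rootApprox {F : Type u} [Field F] {n N M d : ℕ}
    (hN : d * (n - 1) < N) (hM : d * (d + d * d) < M)
    {a : Fin n → F} (ha : Function.Injective a) {v : Fin N → F} (hv : Function.Injective v)
    {w : Fin M → F} (hw : Function.Injective w) :
    ∃ (α β : Fin n → ℕ → Fin N → F) (c : Fin M → F), ∀ Q : MvPolynomial (Fin n) F,
      (compEsym Q).totalDegree ≤ d → Q.totalDegree ≤ d →
      Q = ∑ m, MvPolynomial.C (c m) * MvPolynomial.bind₁ (fun i => rootApprox d (a i) (α i) (β i)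
        fun j => MvPolynomial.C (w m) * (signedPoly (centered a)).eval (MvPolynomial.C (v j)))
          (compEsym Q) := by
  obtain ⟨α, β, hαβ⟩ := exists_aeval_rootApprox_esymm hN ha hv
  -- This functional truncates a polynomial in the perturbation parameter at degree d and evaluates
  -- the result at 1.
  obtain ⟨c, hc⟩ := exists_interpolation_weights hw fun l => if l < d + 1 then 1 else 0
  refine ⟨α, β, c, fun Q hP hQ => ?_⟩
  set P := compEsym Q with hPQ
  let R := MvPolynomial (Fin n) F
  let r : Fin n → R[X] := fun i => rootApprox d (a i) (α i) (β i)
    fun j => X * C ((signedPoly (centered a)).eval (MvPolynomial.C (v j)))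
  let A : R[X] := MvPolynomial.aeval r P
  let b : Fin n → R[X] := fun l =>
    algebraMap F R[X] (MvPolynomial.aeval a (MvPolynomial.esymm (Fin n) F ((l : ℕ) + 1))) +
      X * C (centered a l)
  let B : R[X] := MvPolynomial.aeval b Q
  have hAdeg : A.natDegree < M := by
    refine (natDegree_aeval_le P hP r fun i => natDegree_rootApprox_le d _ _ _ _ fun j => ?_).trans_lt
      hM
    exact natDegree_X_mul_C_le _
  have hBdeg : B.natDegree ≤ d := by
    have := natDegree_aeval_le Q hQ b (m := 1) fun l => by
      refine natDegree_add_le_of_degree_le ?_ ?_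
      · rw [Polynomial.algebraMap_apply, natDegree_C]; exact Nat.zero_le _
      · exact natDegree_X_mul_C_le _
    simpa using this
  -- Modulo X^(d+1) the parameter X is nilpotent, so the root formula is exact there; hence A and B
  -- agree in degrees up to d.
  obtain ⟨T, _, _, π, hker⟩ : ∃ (T : Type u) (_ : CommRing T) (_ : Algebra F T) (π : R[X] →ₐ[F] T),
      ∀ p, π p = 0 ↔ X ^ (d + 1) ∣ p :=
    ⟨R[X] ⧸ Ideal.span {(X : R[X]) ^ (d + 1)}, inferInstance, inferInstance,
      Ideal.Quotient.mkₐ F _, fun p =>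
        Ideal.Quotient.eq_zero_iff_mem.trans Ideal.mem_span_singleton⟩
  have hπX : π X ^ (d + 1) = 0 := by
    rw [← map_pow, hker]
  have hπr : ∀ i, π (r i) = rootApprox d (a i) (α i) (β i) fun j => π X *
      (signedPoly fun l => π (C (centered a l))).eval (algebraMap F T (v j)) := by
    intro i
    simp only [r, map_rootApprox, map_mul]
    congr 1
    funext j
    congr 1
    simp only [eval_signedPoly, map_sum, map_mul, map_pow, map_neg, map_one]
    congr! 3
    exact π.commutes (v j)
  have hπ : π A = π B := by
    have h1 : π A = MvPolynomial.aeval (fun i => π (r i)) P := by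
      rw [← MvPolynomial.comp_aeval_apply]
    have h2 : π B = MvPolynomial.aeval (fun i => π (b i)) Q := by
      rw [← MvPolynomial.comp_aeval_apply]
    rw [h1, h2, hPQ, compEsym, MvPolynomial.comp_aeval_apply]
    congr 2
    funext l
    simp_rw [hπr]
    rw [hαβ _ _ hπX (fun l => π (C (centered a l))) l]
    simp only [b, map_add, map_mul, AlgHom.commutes]
  have hcoeff : ∀ k < d + 1, A.coeff k = B.coeff k := by
    have h : X ^ (d + 1) ∣ A - B := by
      rw [← hker, map_sub, hπ, sub_self]
    rw [X_pow_dvd_iff] at h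
    intro k hk
    simpa [sub_eq_zero] using h k hk
  have hQB : Q = B.eval 1 := by
    have h1 : B.eval 1 = MvPolynomial.aeval (fun l => (b l).eval 1) Q := by
      have := MvPolynomial.comp_aeval_apply (R := F) (f := b)
        ((Polynomial.aeval (1 : R)).restrictScalars F) Q
      simpa [Polynomial.coe_aeval_eq_eval] using this
    rw [h1]
    have h2 : (fun l => (b l).eval 1) = MvPolynomial.X := by
      funext l
      simp only [b, eval_add, eval_mul, eval_X, one_mul, eval_C, centered]
      rw [Polynomial.algebraMap_apply, eval_C, MvPolynomial.algebraMap_eq]; ring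
    rw [h2, MvPolynomial.aeval_X_left_apply]
  have hsum : Q = ∑ l ∈ Finset.range M, A.coeff l * algebraMap F R (if l < d + 1 then 1 else 0) := by
    rw [hQB, eval_eq_sum_range' (Nat.lt_succ_of_le hBdeg)]
    have hsub : Finset.range (d + 1) ⊆ Finset.range M := by
      refine Finset.range_subset_range.2 (lt_of_le_of_lt ?_ hM)
      rcases Nat.eq_zero_or_pos d with rfl | hd
      · simp
      · nlinarith
    rw [← Finset.sum_subset hsub]
    · refine Finset.sum_congr rfl fun k hk => ?_
      rw [hcoeff k (Finset.mem_range.1 hk), if_pos (Finset.mem_range.1 hk)]; simp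
    · intro k _ hk
      rw [if_neg (by simpa using hk)]; simp
  have hcA := hc R A hAdeg
  rw [← hsum] at hcA
  rw [hcA]
  refine Finset.sum_congr rfl fun m _ => ?_
  rw [MvPolynomial.algebraMap_eq]
  congr 1
  let ε : R[X] →ₐ[F] R := (Polynomial.aeval (MvPolynomial.C (w m) : R)).restrictScalars F
  have hε : ∀ p : R[X], ε p = p.eval (MvPolynomial.C (w m)) := fun p => by
    simp [ε, Polynomial.coe_aeval_eq_eval]
  rw [← hε, MvPolynomial.comp_aeval_apply, MvPolynomial.bind₁]
  congr 2
  funext i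
  refine (map_rootApprox d (a i) (α i) (β i) ε _).trans ?_
  simp only [hε, eval_mul, eval_X, eval_C]

/-! ### The degree of a polynomial in the elementary symmetric polynomials -/

open MvPolynomial in
theorem isHomogeneous_esymm (σ : Type*) [Fintype σ] (R : Type*) [CommSemiring R] (k : ℕ) :
    (esymm σ R k).IsHomogeneous k := by
  refine IsHomogeneous.sum _ _ _ fun s hs => ?_
  have := IsHomogeneous.prod s (fun i => (X i : MvPolynomial σ R)) (fun _ => 1)
    fun i _ => isHomogeneous_X R i
  simpa [(Finset.mem_powersetCard.1 hs).2] using this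

theorem compEsym_injective {F : Type u} [Field F] {n : ℕ} :
    Function.Injective (compEsym : MvPolynomial (Fin n) F → MvPolynomial (Fin n) F) := by
  intro p q h
  refine MvPolynomial.esymmAlgHom_fin_injective F le_rfl (Subtype.ext ?_)
  simpa only [MvPolynomial.esymmAlgHom_apply, compEsym] using h

theorem exists_compEsym_eq {F : Type u} [Field F] {n : ℕ} {P : MvPolynomial (Fin n) F}
    (hP : P.IsSymmetric) : ∃ Q, compEsym Q = P := by
  obtain ⟨Q, hQ⟩ := (MvPolynomial.esymmAlgHom_fin_bijective F n).2 ⟨P, hP⟩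
  refine ⟨Q, ?_⟩
  rw [compEsym, ← MvPolynomial.esymmAlgHom_apply, hQ]

open MvPolynomial in
theorem isHomogeneous_compEsym {F : Type u} [Field F] {n m : ℕ} {Q : MvPolynomial (Fin n) F}
    (hQ : IsWeightedHomogeneous (fun i : Fin n => (i : ℕ) + 1) Q m) :
    (compEsym Q).IsHomogeneous m := by
  rw [compEsym, aeval_def, eval₂_eq']
  refine IsHomogeneous.sum _ _ _ fun t ht => ?_
  rw [algebraMap_eq, ← zero_add m]
  refine (isHomogeneous_C _ _).mul ?_
  have h := IsHomogeneous.prod Finset.univ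
    (fun i : Fin n => esymm (Fin n) F ((i : ℕ) + 1) ^ t i) (fun i => ((i : ℕ) + 1) * t i)
    fun i _ => (isHomogeneous_esymm _ _ _).pow _
  have hm := hQ (mem_support_iff.1 ht)
  rw [Finsupp.weight_apply, Finsupp.sum_fintype _ _ (by simp)] at hm
  rw [← hm]
  convert h using 2
  simp [mul_comm]

-- Giving the variable of index i the weight i + 1 makes the substitution carry weighted components
-- to homogeneous components. By injectivity no component of weight above d survives, and the weight
-- of a monomial is at least its degree.
open MvPolynomial in
theorem totalDegree_le_of_compEsym {F : Type u} [Field F] {n d : ℕ} {Q : MvPolynomial (Fin n) F}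
    (hQ : (compEsym Q).totalDegree ≤ d) : Q.totalDegree ≤ d := by
  classical
  set wt : Fin n → ℕ := fun i => (i : ℕ) + 1 with hwt
  have hfin := weightedHomogeneousComponent_finsupp (w := wt) Q
  have hsum : Q = ∑ m ∈ hfin.toFinset, weightedHomogeneousComponent wt m Q := by
    rw [← finsum_eq_sum _ hfin, sum_weightedHomogeneousComponent]
  have hhom : ∀ m, (compEsym (weightedHomogeneousComponent wt m Q)).IsHomogeneous m := fun m =>
    isHomogeneous_compEsym (weightedHomogeneousComponent_isWeightedHomogeneous m Q)
  have hzero : ∀ m, d < m → weightedHomogeneousComponent wt m Q = 0 := by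
    intro m hm
    have h0 : homogeneousComponent m (compEsym Q) = 0 :=
      homogeneousComponent_eq_zero _ _ (hQ.trans_lt hm)
    have h1 : compEsym Q = ∑ k ∈ hfin.toFinset, compEsym (weightedHomogeneousComponent wt k Q) := by
      conv_lhs => rw [hsum]
      simp only [compEsym, map_sum]
    rw [h1, map_sum] at h0
    simp_rw [homogeneousComponent_of_mem (hhom _)] at h0
    by_cases hmem : m ∈ hfin.toFinset
    · rw [Finset.sum_ite_eq, if_pos hmem] at h0
      refine compEsym_injective (h0.trans ?_)
      simp [compEsym]
    · by_contra hne
      exact hmem (hfin.mem_toFinset.2 hne)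
  refine Finset.sup_le fun t ht => ?_
  by_contra hlt
  have hw : d < Finsupp.weight wt t := by
    refine (not_le.1 hlt).trans_le ?_
    rw [Finsupp.weight_apply]
    refine Finset.sum_le_sum fun i _ => ?_
    simp [hwt]; nlinarith
  have h := congrArg (coeff t) (hzero _ hw)
  rw [coeff_weightedHomogeneousComponent, if_pos rfl, coeff_zero] at h
  exact mem_support_iff.1 ht h

/-! ### Substitution in formulas -/

namespace AlgFormula

/-- Replaces every variable by a formula. -/
def subst {F : Type u} {σ τ : Type v} (G : σ → AlgFormula F τ) : AlgFormula F σ → AlgFormula F τ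
  | var i => G i
  | const a => const a
  | sum k f => sum k fun j => subst G (f j)
  | prod k f => prod k fun j => subst G (f j)

theorem poly_subst {F : Type u} [CommSemiring F] {σ τ : Type v} (G : σ → AlgFormula F τ)
    (Φ : AlgFormula F σ) :
    (Φ.subst G).poly = MvPolynomial.bind₁ (fun i => (G i).poly) Φ.poly := by
  induction Φ with
  | var i => simp [subst, poly]
  | const a => simp [subst, poly]
  | sum k f ih => simp [subst, poly, ih]
  | prod k f ih => simp [subst, poly, ih]

theorem size_subst_le {F : Type u} {σ τ : Type v} (G : σ → AlgFormula F τ) {t : ℕ}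
    (hG : ∀ i, (G i).size ≤ t) (Φ : AlgFormula F σ) : (Φ.subst G).size ≤ Φ.size * (t + 1) := by
  have node : ∀ (k : ℕ) (f : Fin k → AlgFormula F σ),
      (∀ j, ((f j).subst G).size ≤ (f j).size * (t + 1)) →
      1 + ∑ j, ((f j).subst G).size ≤ (1 + ∑ j, (f j).size) * (t + 1) := by
    intro k f ih
    rw [add_mul, Finset.sum_mul]
    exact add_le_add (by omega) (Finset.sum_le_sum fun j _ => ih j)
  induction Φ with
  | var i => simpa [subst, size] using (hG i).trans (Nat.le_succ t)
  | const a => simp [subst, size]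
  | sum k f ih => exact node k f ih
  | prod k f ih => exact node k f ih

theorem one_le_size {F : Type u} {σ : Type v} (Φ : AlgFormula F σ) : 1 ≤ Φ.size := by
  cases Φ <;> simp [size]

end AlgFormula

/-! ### Substitution in circuits -/

namespace AlgGate

/-- Relabels the nodes from which the wires come. -/
def map {F : Type u} {σ : Type v} {V W : Type} (e : V → W) : AlgGate F σ V → AlgGate F σ W
  | var i => var i
  | const a => const a
  | sum k f => sum k fun j => e (f j)
  | prod k f => prod k fun j => e (f j)

/-- Relabels the nodes from which the wires come, and replaces an input by a wire. -/
def bind {F : Type u} {σ : Type w} {τ : Type v} {V W : Type} (e : V → W) (o : σ → W) :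
    AlgGate F σ V → AlgGate F τ W
  -- An input keeps its node as a gate of fan-in one; this causes the extra wire per node and the
  -- extra level in the bounds below.
  | var i => sum 1 fun _ => o i
  | const a => const a
  | sum k f => sum k fun j => e (f j)
  | prod k f => prod k fun j => e (f j)

theorem fanIn_map {F : Type u} {σ : Type v} {V W : Type} (e : V → W) (g : AlgGate F σ V) :
    (g.map e).fanIn = g.fanIn := by
  cases g <;> rfl

theorem exists_child_map {F : Type u} {σ : Type v} {V W : Type} (e : V → W) (g : AlgGate F σ V)
    {x : W} (h : ∃ j, (g.map e).child j = x) : ∃ j, e (g.child j) = x := by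
  obtain ⟨j, hj⟩ := h
  cases g with
  | var i => exact j.elim0
  | const a => exact j.elim0
  | sum k f => exact ⟨j, hj⟩
  | prod k f => exact ⟨j, hj⟩

theorem apply_map {F : Type u} [CommSemiring F] {σ : Type v} {V W : Type} (e : V → W)
    (g : AlgGate F σ V) (p : W → MvPolynomial σ F) :
    ((g.map e).apply fun j => p ((g.map e).child j)) = g.apply fun j => p (e (g.child j)) := by
  cases g <;> rfl

theorem sup_map {F : Type u} {σ : Type v} {V W : Type} (e : V → W) (g : AlgGate F σ V)
    (p : W → ℕ) : (Finset.univ.sup fun j => p ((g.map e).child j) + 1) =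
      Finset.univ.sup fun j => p (e (g.child j)) + 1 := by
  cases g <;> rfl

theorem fanIn_bind_le {F : Type u} {σ : Type w} {τ : Type v} {V W : Type} (e : V → W) (o : σ → W)
    (g : AlgGate F σ V) : (g.bind e o : AlgGate F τ W).fanIn ≤ g.fanIn + 1 := by
  cases g <;> simp [bind, fanIn]

theorem exists_child_bind {F : Type u} {σ : Type w} {τ : Type v} {V W : Type} (e : V → W) (o : σ → W)
    (g : AlgGate F σ V) {x : W} (h : ∃ j, (g.bind e o : AlgGate F τ W).child j = x) :
    (∃ j, e (g.child j) = x) ∨ ∃ i, o i = x := by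
  obtain ⟨j, hj⟩ := h
  cases g with
  | var i => exact .inr ⟨i, hj⟩
  | const a => exact j.elim0
  | sum k f => exact .inl ⟨j, hj⟩
  | prod k f => exact .inl ⟨j, hj⟩

theorem apply_bind {F : Type u} [CommSemiring F] {σ : Type w} {τ : Type v} {V W : Type} (e : V → W)
    (o : σ → W) (g : AlgGate F σ V) (p : W → MvPolynomial τ F) (q : V → MvPolynomial σ F)
    (h : ∀ j, p (e (g.child j)) = MvPolynomial.bind₁ (fun i => p (o i)) (q (g.child j))) :
    ((g.bind e o).apply fun j => p ((g.bind e o).child j)) =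
      MvPolynomial.bind₁ (fun i => p (o i)) (g.apply fun j => q (g.child j)) := by
  cases g with
  | var i => simp only [apply, MvPolynomial.bind₁_X_right]; exact Fin.sum_univ_one _
  | const a => exact (MvPolynomial.bind₁_C_right _ _).symm
  | sum k f => simp only [apply, map_sum]; exact Finset.sum_congr rfl fun j _ => h j
  | prod k f => simp only [apply, map_prod]; exact Finset.prod_congr rfl fun j _ => h j

theorem sup_bind_le {F : Type u} {σ : Type w} {τ : Type v} {V W : Type} (e : V → W) (o : σ → W)
    (g : AlgGate F σ V) (p : W → ℕ) (q : V → ℕ) {δ : ℕ} (ho : ∀ i, p (o i) ≤ δ)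
    (h : ∀ j, p (e (g.child j)) ≤ q (g.child j) + δ + 1) :
    (Finset.univ.sup fun j => p ((g.bind e o : AlgGate F τ W).child j) + 1) ≤
      (Finset.univ.sup fun j => q (g.child j) + 1) + δ + 1 := by
  have node : ∀ (k : ℕ) (f : Fin k → V), (∀ j, p (e (f j)) ≤ q (f j) + δ + 1) →
      (Finset.univ.sup fun j => p (e (f j)) + 1) ≤
        (Finset.univ.sup fun j => q (f j) + 1) + δ + 1 := by
    intro k f hf
    refine Finset.sup_le fun j _ => ?_
    have := Finset.le_sup (f := fun j => q (f j) + 1) (Finset.mem_univ j)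
    have := hf j
    omega
  cases g with
  | var i =>
    refine Finset.sup_le fun j _ => ?_
    have : p ((bind e o (var i : AlgGate F σ V) : AlgGate F τ W).child j) ≤ δ := ho i
    omega
  | const a => exact Finset.sup_le fun j => j.elim0
  | sum k f => exact node k f h
  | prod k f => exact node k f h

end AlgGate

namespace AlgCircuit

/-- A node of `D i` as a node of the circuit composed of `C` and the circuits `D i`. -/
abbrev innerNode {F : Type u} {σ : Type} {τ : Type v} (C : AlgCircuit F σ)
    (D : σ → AlgCircuit F τ) (i : σ) (x : (D i).V) : C.V ⊕ (Σ i, (D i).V) :=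
  .inr ⟨i, x⟩

/-- The gates of the circuit in which the inputs of `C` are fed by the circuits `D i`. -/
def substGate {F : Type u} {σ : Type} {τ : Type v} (C : AlgCircuit F σ)
    (D : σ → AlgCircuit F τ) :
    C.V ⊕ (Σ i, (D i).V) → AlgGate F τ (C.V ⊕ (Σ i, (D i).V))
  | .inl b => (C.gate b).bind .inl fun i => innerNode C D i (D i).output
  | .inr x => ((D x.1).gate x.2).map (innerNode C D x.1)

/-- The circuit in which the inputs of `C` are fed by the circuits `D i`. -/
abbrev subst {F : Type u} {σ : Type} {τ : Type v} [Fintype σ] (C : AlgCircuit F σ)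
    (D : σ → AlgCircuit F τ) : AlgCircuit F τ where
  V := C.V ⊕ (Σ i, (D i).V)
  fintypeV :=
    letI := C.fintypeV
    letI := fun i => (D i).fintypeV
    inferInstance
  gate := C.substGate D
  acyclic := by
    -- No wire leads from C into an inner circuit, so inner nodes are accessible on their own.
    have hr : ∀ i (x : (D i).V), Acc (fun a b : C.V ⊕ (Σ i, (D i).V) =>
        ∃ j, (C.substGate D b).child j = a) (.inr ⟨i, x⟩) := by
      intro i x
      induction x using (D i).acyclic.induction with
      | _ x ih =>
        refine ⟨_, fun y hy => ?_⟩
        obtain ⟨j, rfl⟩ := AlgGate.exists_child_map (innerNode C D i) ((D i).gate x) hy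
        exact ih _ ⟨j, rfl⟩
    refine ⟨fun b => ?_⟩
    rcases b with b | ⟨i, x⟩
    · induction b using C.acyclic.induction with
      | _ b ih =>
        refine ⟨_, fun y hy => ?_⟩
        rcases AlgGate.exists_child_bind Sum.inl
            (fun i => innerNode C D i (D i).output)
            (C.gate b) hy with ⟨j, rfl⟩ | ⟨i, rfl⟩
        · exact ih _ ⟨j, rfl⟩
        · exact hr i _
    · exact hr i x
  output := .inl C.output

section subst

variable {F : Type u} {σ : Type} {τ : Type v} [Fintype σ] (C : AlgCircuit F σ)
  (D : σ → AlgCircuit F τ)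

theorem value_subst_inr [CommSemiring F] (i : σ) (x : (D i).V) :
    (C.subst D).value (.inr ⟨i, x⟩) = (D i).value x := by
  induction x using (D i).acyclic.induction with
  | _ x ih =>
    rw [value_eq, value_eq]
    refine (AlgGate.apply_map (innerNode C D i) ((D i).gate x) (C.subst D).value).trans ?_
    congr 1
    funext j
    exact ih _ ⟨j, rfl⟩

theorem value_subst_inl [CommSemiring F] (b : C.V) :
    (C.subst D).value (.inl b) = MvPolynomial.bind₁ (fun i => (D i).poly) (C.value b) := by
  have ho : (fun i => (D i).poly) = fun i => (C.subst D).value (innerNode C D i (D i).output) := by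
    funext i; exact (value_subst_inr C D i _).symm
  rw [ho]
  induction b using C.acyclic.induction with
  | _ b ih =>
    rw [value_eq, C.value_eq]
    exact AlgGate.apply_bind Sum.inl (fun i => innerNode C D i (D i).output) (C.gate b) (C.subst D).value
      C.value fun j => ih _ ⟨j, rfl⟩

theorem poly_subst [CommSemiring F] :
    (C.subst D).poly = MvPolynomial.bind₁ (fun i => (D i).poly) C.poly :=
  value_subst_inl C D C.output

theorem nodeDepth_subst_inr (i : σ) (x : (D i).V) :
    (C.subst D).nodeDepth (.inr ⟨i, x⟩) = (D i).nodeDepth x := by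
  induction x using (D i).acyclic.induction with
  | _ x ih =>
    rw [nodeDepth_eq, nodeDepth_eq]
    refine (AlgGate.sup_map (innerNode C D i) ((D i).gate x) (C.subst D).nodeDepth).trans ?_
    refine Finset.sup_congr rfl fun j _ => ?_
    rw [ih _ ⟨j, rfl⟩]

theorem depth_subst_le {δ : ℕ} (hD : ∀ i, (D i).depth ≤ δ) :
    (C.subst D).depth ≤ C.depth + δ + 1 := by
  have h : ∀ b, (C.subst D).nodeDepth (.inl b) ≤ C.nodeDepth b + δ + 1 := by
    intro b
    induction b using C.acyclic.induction with
    | _ b ih =>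
      rw [nodeDepth_eq, C.nodeDepth_eq]
      exact AlgGate.sup_bind_le Sum.inl (fun i => innerNode C D i (D i).output) (C.gate b)
        (C.subst D).nodeDepth C.nodeDepth
        (fun i => (nodeDepth_subst_inr C D i _).trans_le (hD i)) fun j => ih _ ⟨j, rfl⟩
  exact h C.output

theorem size_subst_le {t : ℕ} (hD : ∀ i, (D i).size ≤ t) :
    (C.subst D).size ≤ 2 * C.size + Fintype.card σ * t := by
  let _ := C.fintypeV
  let _ := fun i => (D i).fintypeV
  have h1 : (C.subst D).size = Fintype.card C.V + ∑ i, Fintype.card (D i).V +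
      (∑ b, (C.substGate D (.inl b)).fanIn +
        ∑ i, ∑ x, (C.substGate D (.inr ⟨i, x⟩)).fanIn) := by
    rw [← Fintype.sum_sigma' fun i x => (C.substGate D (.inr ⟨i, x⟩)).fanIn,
      ← Fintype.sum_sum_type (fun x => (C.substGate D x).fanIn), ← Fintype.card_sigma,
      ← Fintype.card_sum]
    rfl
  have h2 : ∑ b, (C.substGate D (.inl b)).fanIn ≤ ∑ b, (C.gate b).fanIn + Fintype.card C.V := by
    refine (Finset.sum_le_sum fun b _ => AlgGate.fanIn_bind_le Sum.inl
      (fun i => innerNode C D i (D i).output) (C.gate b)).trans ?_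
    rw [Finset.sum_add_distrib]; simp
  have h3 : ∑ i, Fintype.card (D i).V + ∑ i, ∑ x, (C.substGate D (.inr ⟨i, x⟩)).fanIn ≤
      Fintype.card σ * t := by
    rw [← Finset.sum_add_distrib, ← smul_eq_mul, ← Finset.card_univ]
    refine Finset.sum_le_card_nsmul _ _ _ fun i _ => ?_
    simp only [substGate, AlgGate.fanIn_map]
    exact hD i
  have h4 : C.size = Fintype.card C.V + ∑ b, (C.gate b).fanIn := rfl
  omega

end subst

/-- A single gate whose wires come from `k` inputs. -/
abbrev single {F : Type u} (k : ℕ) (g : AlgGate F (Fin k) (Option (Fin k)))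
    (hg : ∀ j, g.child j ≠ none) : AlgCircuit F (Fin k) where
  V := Option (Fin k)
  fintypeV := inferInstance
  gate := fun b => b.elim g .var
  acyclic := by
    have hs : ∀ i : Fin k, Acc (fun a b : Option (Fin k) =>
        ∃ j, (b.elim g AlgGate.var : AlgGate F (Fin k) (Option (Fin k))).child j = a) (some i) :=
      fun i => ⟨_, fun _ ⟨j, _⟩ => j.elim0⟩
    refine ⟨fun b => ?_⟩
    rcases b with _ | i
    · refine ⟨_, fun y hy => ?_⟩
      obtain ⟨j, rfl⟩ := hy
      obtain ⟨i, hi⟩ := Option.ne_none_iff_exists.1 (hg j)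
      exact (congrArg (Acc _) hi).mp (hs i)
    · exact hs i
  output := none

section single

variable {F : Type u} {k : ℕ} (g : AlgGate F (Fin k) (Option (Fin k)))
  (hg : ∀ j, g.child j ≠ none)

theorem value_single_some [CommSemiring F] (i : Fin k) :
    (single k g hg).value (some i) = MvPolynomial.X i := by
  rw [value_eq]; rfl

theorem poly_single [CommSemiring F] :
    (single k g hg).poly = g.apply fun j => (single k g hg).value (g.child j) :=
  value_eq _ _

theorem size_single : (single k g hg).size = k + 1 + g.fanIn := by
  have : (single k g hg).size = Fintype.card (Option (Fin k)) +
    ∑ b : Option (Fin k), (b.elim g AlgGate.var : AlgGate F (Fin k) (Option (Fin k))).fanIn := rfl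
  rw [this, Fintype.sum_option, Fintype.card_option, Fintype.card_fin]
  simp [AlgGate.fanIn]

theorem depth_single_le : (single k g hg).depth ≤ 1 := by
  have hs : ∀ i, (single k g hg).nodeDepth (some i) = 0 := fun i => by
    rw [nodeDepth_eq]; rfl
  rw [depth, nodeDepth_eq]
  refine Finset.sup_le fun j _ => ?_
  obtain ⟨i, hi⟩ := Option.ne_none_iff_exists.1 (hg j)
  have : (single k g hg).nodeDepth (g.child j) = 0 := by rw [← hi]; exact hs i
  exact (congrArg (· + 1) this).le

end single

/-- A circuit with one node and no wires. -/
abbrev leaf {F : Type u} {σ : Type v} (g : AlgGate F σ Unit) (hg : g.fanIn = 0) :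
    AlgCircuit F σ where
  V := Unit
  fintypeV := inferInstance
  gate := fun _ => g
  acyclic := ⟨fun _ => ⟨_, fun _ ⟨j, _⟩ => (Fin.cast hg j).elim0⟩⟩
  output := ()

theorem size_leaf {F : Type u} {σ : Type v} (g : AlgGate F σ Unit) (hg : g.fanIn = 0) :
    (leaf g hg).size = 1 := by
  have : (leaf g hg).size = Fintype.card Unit + ∑ _ : Unit, g.fanIn := rfl
  simp [this, hg]

theorem depth_leaf {F : Type u} {σ : Type v} (g : AlgGate F σ Unit) (hg : g.fanIn = 0) :
    (leaf g hg).depth ≤ 0 := by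
  rw [depth, nodeDepth_eq]
  exact Finset.sup_le fun j _ => (Fin.cast hg j).elim0

theorem one_le_size {F : Type u} {σ : Type v} (C : AlgCircuit F σ) : 1 ≤ C.size := by
  let _ := C.fintypeV
  have h : C.size = Fintype.card C.V + ∑ b, (C.gate b).fanIn := rfl
  have : 0 < Fintype.card C.V := Fintype.card_pos_iff.2 ⟨C.output⟩
  omega

end AlgCircuit

/-! ### Complexity measures -/

/-- The closure properties shared by circuit size with depth and by formula size. -/
structure IsComplexityMeasure {F : Type u} [Field F] {n : ℕ}
    (H : MvPolynomial (Fin n) F → ℕ → ℕ → Prop) : Prop where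
  mono : ∀ {P s s' δ δ'}, H P s δ → s ≤ s' → δ ≤ δ' → H P s' δ'
  X : ∀ i, H (MvPolynomial.X i) 1 0
  C : ∀ a, H (MvPolynomial.C a) 1 0
  -- For circuits, a single gate has size 2k + 1 and depth 1, and substituting into it gives 2(2k +
  -- 1) + kt and δ + 2.
  sum : ∀ {k t δ} {p : Fin k → MvPolynomial (Fin n) F}, (∀ j, H (p j) t δ) →
    H (∑ j, p j) (k * t + 4 * k + 2) (δ + 2)
  prod : ∀ {k t δ} {p : Fin k → MvPolynomial (Fin n) F}, (∀ j, H (p j) t δ) →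
    H (∏ j, p j) (k * t + 4 * k + 2) (δ + 2)
  -- Circuits build each `G i` once, at cost n t; formulas copy it at every leaf, which the term s t
  -- pays for.
  subst : ∀ {P s Δ t δ} {G : Fin n → MvPolynomial (Fin n) F}, H P s Δ → (∀ i, H (G i) t δ) →
    H (MvPolynomial.bind₁ G P) (2 * s + n * t + s * t) (Δ + δ + 1)
  pos : ∀ {P s δ}, H P s δ → 1 ≤ s

theorem HasCircuit.subst {F : Type u} [CommSemiring F] {k : ℕ} {τ : Type v}
    {P : MvPolynomial (Fin k) F} {s Δ t δ : ℕ} {G : Fin k → MvPolynomial τ F}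
    (hP : HasCircuit P s Δ) (hG : ∀ i, HasCircuit (G i) t δ) :
    HasCircuit (MvPolynomial.bind₁ G P) (2 * s + k * t) (Δ + δ + 1) := by
  obtain ⟨C, rfl, hs, hΔ⟩ := hP
  choose D hD hDs hDδ using hG
  refine ⟨C.subst D, ?_, ?_, ?_⟩
  · rw [AlgCircuit.poly_subst]; simp_rw [hD]
  · have := C.size_subst_le D hDs
    rw [Fintype.card_fin] at this
    omega
  · have := C.depth_subst_le D hDδ
    omega

theorem isComplexityMeasure_hasCircuit (F : Type u) [Field F] (n : ℕ) :
    IsComplexityMeasure (F := F) (n := n) HasCircuit where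
  mono := fun ⟨C, h, hs, hδ⟩ h1 h2 => ⟨C, h, hs.trans h1, hδ.trans h2⟩
  X := fun i => ⟨.leaf (.var i) rfl, AlgCircuit.value_eq _ _, (AlgCircuit.size_leaf _ _).le,
    AlgCircuit.depth_leaf _ _⟩
  C := fun a => ⟨.leaf (.const a) rfl, AlgCircuit.value_eq _ _, (AlgCircuit.size_leaf _ _).le,
    AlgCircuit.depth_leaf _ _⟩
  sum := by
    intro k t δ p hp
    have hg : ∀ j, (AlgGate.sum k some : AlgGate F (Fin k) (Option (Fin k))).child j ≠ none :=
      fun j => Option.some_ne_none (α := Fin k) j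
    have h : HasCircuit (∑ j : Fin k, MvPolynomial.X j : MvPolynomial (Fin k) F)
        (k + 1 + k) 1 := by
      refine ⟨.single k (.sum k some) hg, ?_,
        (AlgCircuit.size_single _ _).le, AlgCircuit.depth_single_le _ _⟩
      rw [AlgCircuit.poly_single]
      exact Finset.sum_congr rfl fun j _ => AlgCircuit.value_single_some _ _ _
    obtain ⟨C, hC, hs, hδ⟩ := h.subst hp
    refine ⟨C, by simpa using hC, ?_, ?_⟩ <;> omega
  prod := by
    intro k t δ p hp
    have hg : ∀ j, (AlgGate.prod k some : AlgGate F (Fin k) (Option (Fin k))).child j ≠ none :=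
      fun j => Option.some_ne_none (α := Fin k) j
    have h : HasCircuit (∏ j : Fin k, MvPolynomial.X j : MvPolynomial (Fin k) F)
        (k + 1 + k) 1 := by
      refine ⟨.single k (.prod k some) hg, ?_,
        (AlgCircuit.size_single _ _).le, AlgCircuit.depth_single_le _ _⟩
      rw [AlgCircuit.poly_single]
      exact Finset.prod_congr rfl fun j _ => AlgCircuit.value_single_some _ _ _
    obtain ⟨C, hC, hs, hδ⟩ := h.subst hp
    refine ⟨C, by simpa using hC, ?_, ?_⟩ <;> omega
  subst := fun hP hG => by
    obtain ⟨C, h, hs, hδ⟩ := hP.subst hG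
    exact ⟨C, h, by omega, hδ⟩
  pos := fun ⟨C, _, hs, _⟩ => C.one_le_size.trans hs

theorem isComplexityMeasure_hasFormula (F : Type u) [Field F] (n : ℕ) :
    IsComplexityMeasure (F := F) (n := n) fun P s _ => HasFormula P s where
  mono := fun ⟨Φ, h, hs⟩ h1 _ => ⟨Φ, h, hs.trans h1⟩
  X := fun i => ⟨.var i, rfl, le_rfl⟩
  C := fun a => ⟨.const a, rfl, le_rfl⟩
  sum := by
    intro k t _ p hp
    choose Φ hΦ hs using hp
    refine ⟨.sum k Φ, by simp [AlgFormula.poly, hΦ], ?_⟩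
    have := Finset.sum_le_card_nsmul Finset.univ _ _ fun j _ => hs j
    simp only [Finset.card_univ, Fintype.card_fin, smul_eq_mul] at this
    simp only [AlgFormula.size]; omega
  prod := by
    intro k t _ p hp
    choose Φ hΦ hs using hp
    refine ⟨.prod k Φ, by simp [AlgFormula.poly, hΦ], ?_⟩
    have := Finset.sum_le_card_nsmul Finset.univ _ _ fun j _ => hs j
    simp only [Finset.card_univ, Fintype.card_fin, smul_eq_mul] at this
    simp only [AlgFormula.size]; omega
  subst := by
    rintro P s _ t _ G ⟨Φ, rfl, hs⟩ hG
    choose Ψ hΨ ht using hG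
    refine ⟨Φ.subst Ψ, by rw [AlgFormula.poly_subst]; simp_rw [hΨ], ?_⟩
    refine (AlgFormula.size_subst_le Ψ ht Φ).trans ((Nat.mul_le_mul_right _ hs).trans ?_)
    rw [mul_add]; omega
  pos := fun ⟨Φ, _, hs⟩ => Φ.one_le_size.trans hs

/-! ### Polynomial bounds -/

namespace IsComplexityMeasure

variable {F : Type u} [Field F] {n : ℕ} {H : MvPolynomial (Fin n) F → ℕ → ℕ → Prop} {T : ℕ}

/-- With all sizes measured as powers of one number T, a gate of fan-in at most T^f only adds f + 2
to the exponent. -/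
theorem gate_bound {k f e : ℕ} (hT : 3 ≤ T) (hk : k ≤ T ^ f) :
    k * T ^ e + 4 * k + 2 ≤ T ^ (e + f + 2) := by
  have hf : 1 ≤ T ^ f := Nat.one_le_pow _ _ (by omega)
  have he : 1 ≤ T ^ e := Nat.one_le_pow _ _ (by omega)
  have h9 : 9 ≤ T ^ 2 := Nat.pow_le_pow_left hT 2
  calc k * T ^ e + 4 * k + 2 ≤ T ^ f * T ^ e + 4 * T ^ f + 2 := by gcongr
    _ ≤ T ^ f * T ^ e * 9 := by nlinarith [Nat.mul_le_mul hf he, Nat.mul_le_mul_left (T ^ f) he]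
    _ ≤ T ^ f * T ^ e * T ^ 2 := by gcongr
    _ = T ^ (e + f + 2) := by ring

theorem fintype_sum (hH : IsComplexityMeasure H) (hT : 3 ≤ T) {ι : Type} [Fintype ι]
    {f e δ : ℕ} (hι : Fintype.card ι ≤ T ^ f) {p : ι → MvPolynomial (Fin n) F}
    (hp : ∀ j, H (p j) (T ^ e) δ) : H (∑ j, p j) (T ^ (e + f + 2)) (δ + 2) := by
  rw [← (Fintype.equivFin ι).symm.sum_comp]
  exact hH.mono (hH.sum fun j => hp _) (gate_bound hT hι) le_rfl

theorem range_sum (hH : IsComplexityMeasure H) (hT : 3 ≤ T) {k f e δ : ℕ} (hk : k ≤ T ^ f)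
    {p : ℕ → MvPolynomial (Fin n) F} (hp : ∀ j < k, H (p j) (T ^ e) δ) :
    H (∑ j ∈ Finset.range k, p j) (T ^ (e + f + 2)) (δ + 2) := by
  rw [Finset.sum_range]
  exact hH.fintype_sum hT (by simpa using hk) fun j => hp j j.2

theorem pow (hH : IsComplexityMeasure H) (hT : 3 ≤ T) {k f e δ : ℕ} (hk : k ≤ T ^ f)
    {p : MvPolynomial (Fin n) F} (hp : H p (T ^ e) δ) :
    H (p ^ k) (T ^ (e + f + 2)) (δ + 2) := by
  have h := hH.prod (k := k) fun _ => hp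
  rw [Finset.prod_const, Finset.card_univ, Fintype.card_fin] at h
  exact hH.mono h (gate_bound hT hk) le_rfl

theorem add (hH : IsComplexityMeasure H) (hT : 3 ≤ T) {e δ : ℕ} {p q : MvPolynomial (Fin n) F}
    (hp : H p (T ^ e) δ) (hq : H q (T ^ e) δ) : H (p + q) (T ^ (e + 3)) (δ + 2) := by
  have h := hH.sum (k := 2) (p := ![p, q]) (t := T ^ e) (δ := δ) fun j => by
    fin_cases j
    · exact hp
    · exact hq
  rw [Fin.sum_univ_two] at h
  exact hH.mono h (gate_bound (f := 1) hT (by rw [pow_one]; omega)) le_rfl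

theorem mul (hH : IsComplexityMeasure H) (hT : 3 ≤ T) {e δ : ℕ} {p q : MvPolynomial (Fin n) F}
    (hp : H p (T ^ e) δ) (hq : H q (T ^ e) δ) : H (p * q) (T ^ (e + 3)) (δ + 2) := by
  have h := hH.prod (k := 2) (p := ![p, q]) (t := T ^ e) (δ := δ) fun j => by
    fin_cases j
    · exact hp
    · exact hq
  rw [Fin.prod_univ_two] at h
  exact hH.mono h (gate_bound (f := 1) hT (by rw [pow_one]; omega)) le_rfl

theorem weaken (hH : IsComplexityMeasure H) (hT : 3 ≤ T) {e e' δ δ' : ℕ}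
    {p : MvPolynomial (Fin n) F} (hp : H p (T ^ e) δ) (he : e ≤ e') (hδ : δ ≤ δ') :
    H p (T ^ e') δ' :=
  hH.mono hp (Nat.pow_le_pow_right (by omega) he) hδ

theorem const (hH : IsComplexityMeasure H) (hT : 3 ≤ T) (a : F) (e δ : ℕ) :
    H (MvPolynomial.C a) (T ^ e) δ :=
  hH.mono (hH.C a) (Nat.one_le_pow _ _ (by omega)) (Nat.zero_le _)

theorem C_mul (hH : IsComplexityMeasure H) (hT : 3 ≤ T) {e δ : ℕ} (a : F)
    {p : MvPolynomial (Fin n) F} (hp : H p (T ^ e) δ) :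
    H (MvPolynomial.C a * p) (T ^ (e + 3)) (δ + 2) :=
  hH.mul hT (hH.const hT a e δ) hp

theorem centered (hH : IsComplexityMeasure H) (hT : 3 ≤ T) (a : Fin n → F) (l : Fin n) :
    H (centered a l) (T ^ 3) 2 := by
  rw [_root_.centered, sub_eq_add_neg, ← map_neg]
  exact hH.add hT (by simpa using hH.X l) (hH.const hT _ 0 0)

theorem eval_signedPoly (hH : IsComplexityMeasure H) (hT : 3 ≤ T) (hn : n ≤ T)
    {ζ : Fin n → MvPolynomial (Fin n) F} {e δ : ℕ} (hζ : ∀ l, H (ζ l) (T ^ e) δ) (v : F) :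
    H ((signedPoly ζ).eval (MvPolynomial.C v)) (T ^ (e + 6)) (δ + 4) := by
  rw [_root_.eval_signedPoly]
  refine hH.fintype_sum hT (f := 1) (e := e + 3) (by simpa using hn) fun l => ?_
  -- The sign and the power of v merge into one constant.
  have h : (-1 : MvPolynomial (Fin n) F) ^ ((l : ℕ) + 1) * ζ l *
      MvPolynomial.C v ^ (n - 1 - (l : ℕ)) =
      MvPolynomial.C ((-1) ^ ((l : ℕ) + 1) * v ^ (n - 1 - (l : ℕ))) * ζ l := by
    simp only [map_mul, map_pow, map_neg, map_one]; ring
  rw [h]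
  exact hH.C_mul hT _ (hζ l)

theorem powerSum (hH : IsComplexityMeasure H) (hT : 3 ≤ T) {N d : ℕ} (hd : d + 1 ≤ T)
    (hN : N ≤ T ^ 2) (c : ℕ → Fin N → F) {x : Fin N → MvPolynomial (Fin n) F} {e δ : ℕ}
    (hx : ∀ j, H (x j) (T ^ e) δ) : H (powerSum d c x) (T ^ (e + 13)) (δ + 8) := by
  refine hH.range_sum hT (f := 1) (e := e + 10) (by simpa using hd) fun k hk => ?_
  refine hH.fintype_sum hT (f := 2) (e := e + 6) (by simpa using hN) fun j => ?_
  exact hH.C_mul hT _ (hH.pow hT (f := 1) (by rw [pow_one]; omega) (hx j))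

theorem rootApprox (hH : IsComplexityMeasure H) (hT : 3 ≤ T) {N d : ℕ} (hd : d + 1 ≤ T)
    (hN : N ≤ T ^ 2) (a : F) (α β : ℕ → Fin N → F) {x : Fin N → MvPolynomial (Fin n) F}
    {e δ : ℕ} (hx : ∀ j, H (x j) (T ^ e) δ) :
    H (rootApprox d a α β x) (T ^ (e + 31)) (δ + 20) := by
  have hsub : H (1 - _root_.powerSum d α x) (T ^ (e + 19)) (δ + 12) := by
    have h : (1 : MvPolynomial (Fin n) F) - _root_.powerSum d α x =
        MvPolynomial.C 1 + MvPolynomial.C (-1) * _root_.powerSum d α x := by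
      simp only [map_neg, map_one]; ring
    rw [h]
    exact hH.add hT (hH.const hT _ _ _) (hH.C_mul hT _ (hH.powerSum hT hd hN α hx))
  have hgeom := hH.range_sum hT (f := 1) (k := d + 1) (by simpa using hd) fun m hm =>
    hH.pow hT (k := m) (f := 1) (by rw [pow_one]; omega) hsub
  exact hH.add hT (hH.const hT _ _ _) (hH.mul hT
    (hH.weaken hT (hH.powerSum hT hd hN β hx) (by omega) (by omega)) hgeom)

theorem bind₁ (hH : IsComplexityMeasure H) (hT : 4 ≤ T) (hn : n ≤ T) {s Δ e δ : ℕ} (hs : s ≤ T)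
    {P : MvPolynomial (Fin n) F} (hP : H P s Δ) {G : Fin n → MvPolynomial (Fin n) F}
    (hG : ∀ i, H (G i) (T ^ e) δ) :
    H (MvPolynomial.bind₁ G P) (T ^ (e + 2)) (Δ + δ + 1) := by
  refine hH.mono (hH.subst hP hG) ?_ le_rfl
  have he : 1 ≤ T ^ e := Nat.one_le_pow _ _ (by omega)
  calc 2 * s + n * T ^ e + s * T ^ e ≤ 2 * T + T * T ^ e + T * T ^ e := by gcongr
    _ ≤ T ^ e * (4 * T) := by nlinarith
    _ ≤ T ^ e * (T * T) := by gcongr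
    _ = T ^ (e + 2) := by ring

end IsComplexityMeasure

/-! ### The main theorem -/

theorem exists_injective_of_le_mk {F : Type u} {m N : ℕ} (hN : (N : Cardinal) ≤ Cardinal.mk F)
    (hm : m ≤ N) : ∃ a : Fin m → F, Function.Injective a := by
  have h : Cardinal.lift.{u} (Cardinal.mk (Fin m)) ≤ Cardinal.lift.{0} (Cardinal.mk F) := by
    simpa using (Nat.cast_le.2 hm).trans hN
  obtain ⟨f⟩ := Cardinal.lift_mk_le'.1 h
  exact ⟨f, f.injective⟩

/-- Separates the case in which the field may be too small for the interpolation nodes. -/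
theorem compEsym_eq_self {F : Type u} [Field F] {n : ℕ} (hn : n ≤ 1)
    (Q : MvPolynomial (Fin n) F) : compEsym Q = Q := by
  have h : (fun i : Fin n => MvPolynomial.esymm (Fin n) F ((i : ℕ) + 1)) = MvPolynomial.X := by
    funext i
    obtain rfl : n = 1 := by have := i.2; omega
    obtain rfl := Subsingleton.elim i 0
    simp [MvPolynomial.esymm_one]
  rw [compEsym, h, MvPolynomial.aeval_X_left_apply]

theorem IsComplexityMeasure.of_compEsym {F : Type u} [Field F] {n d s Δ : ℕ}
    (hF : (((n * d * s) ^ 3 : ℕ) : Cardinal) ≤ Cardinal.mk F)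
    {H : MvPolynomial (Fin n) F → ℕ → ℕ → Prop} (hH : IsComplexityMeasure H)
    {Q : MvPolynomial (Fin n) F} (hd : (compEsym Q).totalDegree ≤ d)
    (hP : H (compEsym Q) s Δ) : H Q ((s + d + n + 1) ^ 53) (Δ + 33) := by
  have hs := hH.pos hP
  set T := s + d + n + 1 with hTdef
  have hsT : s ≤ T ^ 53 := (by omega : s ≤ T).trans (Nat.le_self_pow (by norm_num) T)
  rcases Nat.lt_or_ge 1 n with hn | hn
  swap
  · rw [compEsym_eq_self hn] at hP
    exact hH.mono hP hsT (Nat.le_add_right _ _)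
  have hQ := totalDegree_le_of_compEsym hd
  -- For d = 0 the cardinality hypothesis provides no nodes, but Q is constant.
  rcases Nat.eq_zero_or_pos d with rfl | hdpos
  · rw [MvPolynomial.totalDegree_eq_zero_iff_eq_C.1 (Nat.le_zero.1 hQ)]
    exact hH.const (by omega) _ _ _
  have hnd : 2 * d ≤ n * d * s :=
    (Nat.mul_le_mul_right d hn).trans (Nat.le_mul_of_pos_right _ hs)
  have hnd' : n * d ≤ n * d * s := Nat.le_mul_of_pos_right _ hs
  have hX : n * d * s ≤ (n * d * s) ^ 3 := Nat.le_self_pow (by norm_num) _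
  -- The cubic field bound comes from here: n ≥ 2 and s ≥ 1 give nds ≥ 2d, and 8d³ ≥ d³ + d² + 1.
  have hM : d * (d + d * d) + 1 ≤ (n * d * s) ^ 3 := by
    refine le_trans ?_ (Nat.pow_le_pow_left hnd 3)
    nlinarith [Nat.mul_le_mul hdpos hdpos, Nat.mul_le_mul (Nat.mul_le_mul hdpos hdpos) hdpos,
      Nat.mul_le_mul_left (d * d) hdpos]
  obtain ⟨a, ha⟩ := exists_injective_of_le_mk hF
    (((Nat.le_mul_of_pos_right n hdpos).trans hnd').trans hX)
  obtain ⟨v, hv⟩ := exists_injective_of_le_mk hF (hnd'.trans hX)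
  obtain ⟨w, hw⟩ := exists_injective_of_le_mk hF hM
  have hN : d * (n - 1) < n * d := by
    rw [mul_comm n d]; exact Nat.mul_lt_mul_of_pos_left (by omega) hdpos
  obtain ⟨α, β, c, h⟩ := exists_eq_sum_bind₁_rootApprox hN (Nat.lt_succ_self _) ha hv hw
  rw [h Q hd hQ]
  have hT : 4 ≤ T := by omega
  have hT' : 3 ≤ T := by omega
  have hcard : d * (d + d * d) + 1 ≤ T ^ 3 := by
    have hdT : d + 1 ≤ T := by omega
    refine le_trans ?_ (Nat.pow_le_pow_left hdT 3)
    nlinarith [Nat.mul_le_mul hdpos hdpos]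
  refine hH.fintype_sum hT' (f := 3) (e := 48) (by simpa using hcard) fun m => ?_
  refine hH.C_mul hT' (e := 45) (δ := Δ + 29) _ ?_
  have hx : ∀ j, H (MvPolynomial.C (w m) *
      (signedPoly (_root_.centered a)).eval (MvPolynomial.C (v j))) (T ^ 12) 8 := fun j =>
    hH.C_mul hT' _ (hH.eval_signedPoly hT' (by omega) (hH.centered hT' a) (v j))
  have hN2 : n * d ≤ T ^ 2 := by
    rw [pow_two]; exact Nat.mul_le_mul (by omega) (by omega)
  exact hH.weaken hT' (hH.bind₁ hT (by omega) (by omega) hP fun i =>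
    hH.rootApprox hT' (by omega) hN2 (a i) (α i) (β i) hx) (by omega) (by omega)

theorem theorem1p2 :
    -- absolute constants: the field-size exponent, the polynomial bound, the depth overhead
    ∃ c K k : ℕ, 0 < c ∧
      ∀ (F : Type u) [Field F] (n d s : ℕ),
        (((n * d * s) ^ c : ℕ) : Cardinal) ≤ Cardinal.mk F →
        ∀ P : MvPolynomial (Fin n) F, P.IsSymmetric → P.totalDegree ≤ d →
          ∃ Q : MvPolynomial (Fin n) F,
            (compEsym Q = P ∧ ∀ Q' : MvPolynomial (Fin n) F, compEsym Q' = P → Q' = Q) ∧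
            Q.totalDegree ≤ d ∧
            (∀ Δ : ℕ, HasCircuit P s Δ → HasCircuit Q (K * (s + d + n + 1) ^ K) (Δ + k)) ∧
            (HasFormula P s → HasFormula Q (K * (s + d + n + 1) ^ K)) := by
  refine ⟨3, 53, 33, by norm_num, fun F _ n d s hF P hP hd => ?_⟩
  obtain ⟨Q, rfl⟩ := exists_compEsym_eq hP
  have hK : (s + d + n + 1) ^ 53 ≤ 53 * (s + d + n + 1) ^ 53 :=
    Nat.le_mul_of_pos_left _ (by norm_num)
  have hC := isComplexityMeasure_hasCircuit F n
  have hΦ := isComplexityMeasure_hasFormula F n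
  exact ⟨Q, ⟨rfl, fun Q' h => compEsym_injective h⟩, totalDegree_le_of_compEsym hd,
    fun Δ h => hC.mono (hC.of_compEsym hF hd h) hK le_rfl,
    -- The formula measure ignores its depth argument, so 0 is an arbitrary choice.
    fun h => hΦ.mono (hΦ.of_compEsym (Δ := 0) hF hd h) hK (le_refl 33)⟩
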